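/- All Polish spaces carry their Borel $\sigma$-algebras. A stochastic relation $K: X\rightsquigarrow Y$ between measurable spaces assigns to each $x\in X$ a subprobability measure $K(x)$ on $Y$ such that $x\mapsto K(x)(D)$ is measurable for every measurable $D\subseteq Y$. A morphism $(f,g)$ from $K: X\rightsquigarrow Y$ to $L: X'\rightsquigarrow Y'$ is a pair of measurable maps $f: X\to X'$, $g: Y\to Y'$ with $L(f(x))(D)=K(x)(g^{-1}[D])$ for all $x\in X$ and all measurable $D\subseteq Y'$; it is surjective if $f$ and $g$ are onto, and an isomorphism if it has an inverse morphism. An equivalence relation $\rho$ on $X$ is smooth if there are measurable sets $A_n\subseteq X$ ($n\in\mathbb N$) with $x\mathrel{\rho}x'$ iff for all $n$ ($x\in A_n\Leftrightarrow x'\in A_n$). Quotients carry the final $\sigma$-algebra of the quotient map. A congruence for $K: X\rightsquigarrow Y$ is a pair $(\kappa,\lambda)$ of smooth equivalence relations, $\kappa$ on $X$ and $\lambda$ on $Y$, for which there is a (necessarily unique) stochastic relation $K_{\kappa,\lambda}: X/\kappa\rightsquigarrow Y/\lambda$, the factor relation, such that the pair of quotient maps is a morphism $K\to K_{\kappa,\lambda}$.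 Stochastic relations $K_1: X_1\rightsquigarrow Y_1$ and $K_2: X_2\rightsquigarrow Y_2$ are bisimilar if there are a stochastic relation $M: A\rightsquigarrow B$ between measurable spaces, called mediating, and surjective morphisms $(f_i,g_i): M\to K_i$ ($i=1,2$) such that the $\sigma$-algebra of common events $\{g_1^{-1}[D] : D\subseteq Y_1 \text{ measurable}\}\cap\{g_2^{-1}[D] : D\subseteq Y_2\text{ measurable}\}$ contains a set other than $\emptyset$ and $B$. **Theorem.** Let $X_1,Y_1,X_2,Y_2$ be Polish spaces and let $K_1: X_1\rightsquigarrow Y_1$, $K_2: X_2\rightsquigarrow Y_2$ be stochastic relations. 1. Suppose that $K_1$ and $K_2$ are logically equivalent, that is, there are congruences $(\kappa_1,\lambda_1)$ for $K_1$ and $(\kappa_2,\lambda_2)$ for $K_2$ whose factor relations are isomorphic, and suppose that these can be chosen such that $\lambda_1$ (equivalently, $\lambda_2$) has at least two equivalence classes. Then $K_1$ and $K_2$ are bisimilar, with a mediating relation $M: A\rightsquigarrow B$ where $A$ and $B$ are Polish spaces. 2. Consequently Polish spaces are closed under bisimulation: if $K_1$ and $K_2$ are bisimilar, with a mediating relation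 over arbitrary measurable spaces, then they also have a mediating relation over Polish spaces. -/

import Mathlib

open MeasureTheory ProbabilityTheory

universe u₁ u₂ v₁ v₂ w₁ w₂

/-- A stochastic relation from `X` to `Y`: a kernel all of whose values are subprobability
measures. -/
structure StochRel (X : Type u₁) (Y : Type v₁) [MeasurableSpace X] [MeasurableSpace Y] where
  toKernel : Kernel X Y
  measure_univ_le_one : ∀ x, toKernel x Set.univ ≤ 1

namespace StochRel

section Morphisms

variable {X₁ : Type u₁} {Y₁ : Type v₁} {X₂ : Type u₂} {Y₂ : Type v₂}
  [MeasurableSpace X₁] [MeasurableSpace Y₁] [MeasurableSpace X₂] [MeasurableSpace Y₂]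

/-- `(f, g)` is a morphism `K₁ → K₂`: both maps are measurable and
`K₂ (f x) D = K₁ x (g⁻¹ D)` for all points `x` and measurable sets `D`. -/
structure IsMorphism (K₁ : StochRel X₁ Y₁) (K₂ : StochRel X₂ Y₂) (f : X₁ → X₂) (g : Y₁ → Y₂) :
    Prop where
  measurable_fst : Measurable f
  measurable_snd : Measurable g
  comm : ∀ x, ∀ D : Set Y₂, MeasurableSet D →
    K₂.toKernel (f x) D = K₁.toKernel x (g ⁻¹' D)

/-- `K₁` and `K₂` are isomorphic: there is a morphism with a two-sided inverse morphism. -/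
def Isomorphic (K₁ : StochRel X₁ Y₁) (K₂ : StochRel X₂ Y₂) : Prop :=
  ∃ (φ : X₁ ≃ X₂) (ψ : Y₁ ≃ Y₂), IsMorphism K₁ K₂ φ ψ ∧ IsMorphism K₂ K₁ φ.symm ψ.symm

/-- The σ-algebra of common events of two maps `g₁, g₂` with the same domain: the intersection of
the σ-algebras of preimages of measurable sets under `g₁` and under `g₂`. -/
abbrev commonEvents {B : Type w₂} (g₁ : B → Y₁) (g₂ : B → Y₂) : MeasurableSpace B :=
  MeasurableSpace.comap g₁ inferInstance ⊓ MeasurableSpace.comap g₂ inferInstance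

/-- `M` is a mediating relation for `K₁` and `K₂`: there are surjective morphisms
`(f₁, g₁) : M → K₁` and `(f₂, g₂) : M → K₂` for which some common event is neither empty nor
everything. -/
def IsMediating {A : Type w₁} {B : Type w₂} [MeasurableSpace A] [MeasurableSpace B]
    (M : StochRel A B) (K₁ : StochRel X₁ Y₁) (K₂ : StochRel X₂ Y₂) : Prop :=
  ∃ (f₁ : A → X₁) (g₁ : B → Y₁) (f₂ : A → X₂) (g₂ : B → Y₂),
    IsMorphism M K₁ f₁ g₁ ∧ IsMorphism M K₂ f₂ g₂ ∧
    Function.Surjective f₁ ∧ Function.Surjective g₁ ∧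
    Function.Surjective f₂ ∧ Function.Surjective g₂ ∧
    ∃ C : Set B, MeasurableSet[commonEvents g₁ g₂] C ∧ C ≠ ∅ ∧ C ≠ Set.univ

/-- `K₁` and `K₂` are bisimilar: they have a mediating relation over measurable spaces. -/
def Bisimilar (K₁ : StochRel X₁ Y₁) (K₂ : StochRel X₂ Y₂) : Prop :=
  ∃ (A : Type w₁) (B : Type w₂) (_ : MeasurableSpace A) (_ : MeasurableSpace B)
    (M : StochRel A B), IsMediating M K₁ K₂

/-- `K₁` and `K₂` are bisimilar with a mediating relation over Polish spaces (equipped with their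
Borel sets). -/
def PolishBisimilar (K₁ : StochRel X₁ Y₁) (K₂ : StochRel X₂ Y₂) : Prop :=
  ∃ (A : Type w₁) (B : Type w₂)
    (_ : TopologicalSpace A) (_ : PolishSpace A) (_ : MeasurableSpace A) (_ : BorelSpace A)
    (_ : TopologicalSpace B) (_ : PolishSpace B) (_ : MeasurableSpace B) (_ : BorelSpace B)
    (M : StochRel A B), IsMediating M K₁ K₂

theorem PolishBisimilar.bisimilar {K₁ : StochRel X₁ Y₁} {K₂ : StochRel X₂ Y₂}
    (h : PolishBisimilar.{u₁, u₂, v₁, v₂, w₁, w₂} K₁ K₂) :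
    Bisimilar.{u₁, u₂, v₁, v₂, w₁, w₂} K₁ K₂ := by
  obtain ⟨A, B, _, _, mA, _, _, _, mB, _, M, hM⟩ := h
  exact ⟨A, B, mA, mB, M, hM⟩

end Morphisms

section Congruences

/-- An equivalence relation is smooth if it is determined by a sequence of measurable sets. -/
def IsSmooth {X : Type u₁} [MeasurableSpace X] (r : Setoid X) : Prop :=
  ∃ S : ℕ → Set X, (∀ n, MeasurableSet (S n)) ∧
    ∀ x x', r x x' ↔ ∀ n, (x ∈ S n ↔ x' ∈ S n)

/-- `F` is the factor relation of `K` modulo `(r, s)`: the pair of quotient maps is a morphism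
`K → F`. The quotients carry the final σ-algebras of the quotient maps. -/
def IsFactorRelation {X : Type u₁} {Y : Type v₁} [MeasurableSpace X] [MeasurableSpace Y]
    (K : StochRel X Y) (r : Setoid X) (s : Setoid Y)
    (F : StochRel (Quotient r) (Quotient s)) : Prop :=
  IsMorphism K F (Quotient.mk r) (Quotient.mk s)

/-- A congruence for `K`: a pair of smooth equivalence relations admitting a factor relation. -/
def IsCongruence {X : Type u₁} {Y : Type v₁} [MeasurableSpace X] [MeasurableSpace Y]
    (K : StochRel X Y) (r : Setoid X) (s : Setoid Y) : Prop :=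
  IsSmooth r ∧ IsSmooth s ∧ ∃ F, IsFactorRelation K r s F

/-- The factor relation is unique. -/
theorem IsFactorRelation.unique {X : Type u₁} {Y : Type v₁} [MeasurableSpace X]
    [MeasurableSpace Y] {K : StochRel X Y} {r : Setoid X} {s : Setoid Y}
    {F G : StochRel (Quotient r) (Quotient s)}
    (hF : IsFactorRelation K r s F) (hG : IsFactorRelation K r s G) : F = G := by
  obtain ⟨F, hF'⟩ := F
  obtain ⟨G, hG'⟩ := G
  congr 1
  ext q D hD
  induction q using Quotient.inductionOn with
  | h x => exact (hF.comm x D hD).trans (hG.comm x D hD).symm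

variable {X₁ : Type u₁} {Y₁ : Type v₁} {X₂ : Type u₂} {Y₂ : Type v₂}
  [MeasurableSpace X₁] [MeasurableSpace Y₁] [MeasurableSpace X₂] [MeasurableSpace Y₂]

/-- `K₁` and `K₂` are logically equivalent, as witnessed by the congruences `(r₁, s₁)` for `K₁` and
`(r₂, s₂)` for `K₂`: the factor relations are isomorphic. -/
def LogicallyEquivalentVia (K₁ : StochRel X₁ Y₁) (K₂ : StochRel X₂ Y₂)
    (r₁ : Setoid X₁) (s₁ : Setoid Y₁) (r₂ : Setoid X₂) (s₂ : Setoid Y₂) : Prop :=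
  IsCongruence K₁ r₁ s₁ ∧ IsCongruence K₂ r₂ s₂ ∧
    ∃ F₁ F₂, IsFactorRelation K₁ r₁ s₁ F₁ ∧ IsFactorRelation K₂ r₂ s₂ F₂ ∧ Isomorphic F₁ F₂

end Congruences

end StochRel

/-! Both parts reduce to `PolishBisimilar.of_fibreProduct`. Points of each side are compared through
measurable maps `e₁, e₂` and `c₁, c₂` into common spaces. On the fibre products, the two kernels
have the same image in `Z` and so can be coupled over it, measurably in the parameter, by
disintegration. Equal ranges make the projections surjective. For part 1 the comparison maps factor
through the quotients, embedded in Cantor space. Part 2 does not pass through congruences: a single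
nontrivial common event already supplies comparison maps, with `Z` the two-point space. -/

/-- Two finite kernels with the same image under `c₁` and `c₂` have a coupling concentrated on the
fibre product of `c₁` and `c₂`: condition both on the common image and take the conditionally
independent product. -/
theorem ProbabilityTheory.Kernel.exists_coupling_of_map_eq {A Y₁ Y₂ Z : Type*}
    [MeasurableSpace A] [MeasurableSpace Y₁] [MeasurableSpace Y₂] [MeasurableSpace Z]
    [StandardBorelSpace Y₁] [StandardBorelSpace Y₂] [StandardBorelSpace Z]
    [Nonempty Y₁] [Nonempty Y₂]
    (κ₁ : Kernel A Y₁) (κ₂ : Kernel A Y₂) [IsFiniteKernel κ₁] [IsFiniteKernel κ₂]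
    {c₁ : Y₁ → Z} {c₂ : Y₂ → Z} (hc₁ : Measurable c₁) (hc₂ : Measurable c₂)
    (h : κ₁.map c₁ = κ₂.map c₂) :
    ∃ N : Kernel A (Y₁ × Y₂),
      (∀ a, ∀ D : Set Y₁, MeasurableSet D → N a (Prod.fst ⁻¹' D) = κ₁ a D) ∧
      (∀ a, ∀ D : Set Y₂, MeasurableSet D → N a (Prod.snd ⁻¹' D) = κ₂ a D) ∧
      ∀ a, N a {p | c₁ p.1 = c₂ p.2}ᶜ = 0 := by
  have hg₁ : Measurable fun y => (c₁ y, y) := hc₁.prodMk measurable_id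
  have hg₂ : Measurable fun y => (c₂ y, y) := hc₂.prodMk measurable_id
  set η₁ := κ₁.map fun y => (c₁ y, y) with hη₁
  set η₂ := κ₂.map fun y => (c₂ y, y) with hη₂
  have hfst₁ : η₁.fst = κ₁.map c₁ := Kernel.fst_map_prod κ₁ measurable_id
  have hfst₂ : η₂.fst = κ₁.map c₁ := (Kernel.fst_map_prod κ₂ measurable_id).trans h.symm
  -- The `Z`-coordinate is kept for now: each pair marginal of `N` lives on a graph `z = cᵢ yᵢ`, and
  -- together the two graphs force `c₁ y₁ = c₂ y₂` almost everywhere.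
  set N := κ₁.map c₁ ⊗ₖ (η₁.condKernel ×ₖ η₂.condKernel) with hN
  have marg₁ : ∀ a, ∀ E : Set (Z × Y₁), MeasurableSet E →
      N a ((fun q : Z × Y₁ × Y₂ => (q.1, q.2.1)) ⁻¹' E) = κ₁ a ((fun y => (c₁ y, y)) ⁻¹' E) := by
    intro a E hE
    rw [← Kernel.map_apply' κ₁ hg₁ a hE, ← hη₁]
    conv_rhs => rw [← η₁.disintegrate η₁.condKernel, hfst₁, Kernel.compProd_apply hE]
    rw [hN, Kernel.compProd_apply (hE.preimage (by fun_prop))]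
    refine lintegral_congr fun z => ?_
    rw [Kernel.prod_apply]
    have : Prod.mk z ⁻¹' ((fun q : Z × Y₁ × Y₂ => (q.1, q.2.1)) ⁻¹' E)
        = (Prod.mk z ⁻¹' E) ×ˢ (Set.univ : Set Y₂) := by
      ext q; simp
    rw [this, Measure.prod_prod]
    simp
  have marg₂ : ∀ a, ∀ E : Set (Z × Y₂), MeasurableSet E →
      N a ((fun q : Z × Y₁ × Y₂ => (q.1, q.2.2)) ⁻¹' E) = κ₂ a ((fun y => (c₂ y, y)) ⁻¹' E) := by
    intro a E hE
    rw [← Kernel.map_apply' κ₂ hg₂ a hE, ← hη₂]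
    conv_rhs => rw [← η₂.disintegrate η₂.condKernel, hfst₂, Kernel.compProd_apply hE]
    rw [hN, Kernel.compProd_apply (hE.preimage (by fun_prop))]
    refine lintegral_congr fun z => ?_
    rw [Kernel.prod_apply]
    have : Prod.mk z ⁻¹' ((fun q : Z × Y₁ × Y₂ => (q.1, q.2.2)) ⁻¹' E)
        = (Set.univ : Set Y₁) ×ˢ (Prod.mk z ⁻¹' E) := by
      ext q; simp
    rw [this, Measure.prod_prod]
    simp
  have hB : MeasurableSet {p : Y₁ × Y₂ | c₁ p.1 = c₂ p.2} :=
    measurableSet_eq_fun (hc₁.comp measurable_fst) (hc₂.comp measurable_snd)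
  refine ⟨N.map Prod.snd, fun a D hD => ?_, fun a D hD => ?_, fun a => ?_⟩
  · rw [Kernel.map_apply' _ measurable_snd _ (hD.preimage measurable_fst)]
    exact marg₁ a (Prod.snd ⁻¹' D) (hD.preimage measurable_snd)
  · rw [Kernel.map_apply' _ measurable_snd _ (hD.preimage measurable_snd)]
    exact marg₂ a (Prod.snd ⁻¹' D) (hD.preimage measurable_snd)
  · rw [Kernel.map_apply' _ measurable_snd _ hB.compl]
    have hE₁ : MeasurableSet {q : Z × Y₁ | q.1 = c₁ q.2}ᶜ :=
      (measurableSet_eq_fun measurable_fst (hc₁.comp measurable_snd)).compl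
    have hE₂ : MeasurableSet {q : Z × Y₂ | q.1 = c₂ q.2}ᶜ :=
      (measurableSet_eq_fun measurable_fst (hc₂.comp measurable_snd)).compl
    refine measure_mono_null (t :=
      ((fun q : Z × Y₁ × Y₂ => (q.1, q.2.1)) ⁻¹' {q : Z × Y₁ | q.1 = c₁ q.2}ᶜ) ∪
      ((fun q : Z × Y₁ × Y₂ => (q.1, q.2.2)) ⁻¹' {q : Z × Y₂ | q.1 = c₂ q.2}ᶜ)) ?_
      (measure_union_null ?_ ?_)
    · intro q hq
      by_contra hcon
      simp only [Set.mem_union, Set.mem_preimage, Set.mem_compl_iff, Set.mem_ofPred_eq, not_or,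
        not_not] at hcon hq
      exact hq (hcon.1.symm.trans hcon.2)
    · rw [marg₁ a _ hE₁]; simp
    · rw [marg₂ a _ hE₂]; simp

namespace StochRel

theorem isFiniteKernel {X : Type*} {Y : Type*} [MeasurableSpace X] [MeasurableSpace Y]
    (K : StochRel X Y) : IsFiniteKernel K.toKernel :=
  ⟨⟨1, ENNReal.one_lt_top, K.measure_univ_le_one⟩⟩

/-- The quotient by a smooth equivalence relation is countably separated: it has a measurable
injection into the Cantor space. -/
theorem IsSmooth.exists_measurable_injective {X : Type*} [MeasurableSpace X] {r : Setoid X}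
    (h : IsSmooth r) : ∃ d : Quotient r → ℕ → Prop, Measurable d ∧ Function.Injective d := by
  obtain ⟨S, hS, hr⟩ := h
  refine ⟨Quotient.lift (fun x n => x ∈ S n) fun x x' hx =>
    funext fun n => propext ((hr x x').1 hx n),
    measurable_from_quotient.2 (measurable_pi_lambda _ fun n => measurable_mem.2 (hS n)), ?_⟩
  intro q q'
  induction q using Quotient.inductionOn
  induction q' using Quotient.inductionOn
  exact fun hq => Quotient.sound ((hr _ _).2 fun n => (congrFun hq n).to_iff)

section

variable {X₁ : Type u₁} {Y₁ : Type v₁} {X₂ : Type u₂} {Y₂ : Type v₂}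
  [MeasurableSpace X₁] [MeasurableSpace Y₁] [MeasurableSpace X₂] [MeasurableSpace Y₂]
  [StandardBorelSpace X₁] [StandardBorelSpace Y₁] [StandardBorelSpace X₂] [StandardBorelSpace Y₂]

/-- The fibre products of `e₁, e₂` and of `c₁, c₂` carry a mediating relation as soon as
`K₁ x₁` and `K₂ x₂` have the same image under `c₁` and `c₂` whenever `e₁ x₁ = e₂ x₂`. -/
theorem PolishBisimilar.of_fibreProduct {W Z : Type*} [MeasurableSpace W] [MeasurableEq W]
    [MeasurableSpace Z] [StandardBorelSpace Z] (K₁ : StochRel X₁ Y₁) (K₂ : StochRel X₂ Y₂)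
    {e₁ : X₁ → W} {e₂ : X₂ → W} {c₁ : Y₁ → Z} {c₂ : Y₂ → Z}
    (he₁ : Measurable e₁) (he₂ : Measurable e₂) (hc₁ : Measurable c₁) (hc₂ : Measurable c₂)
    (he : Set.range e₁ = Set.range e₂) (hc : Set.range c₁ = Set.range c₂)
    (hK : ∀ x₁ x₂, e₁ x₁ = e₂ x₂ → ∀ D : Set Z, MeasurableSet D →
      K₁.toKernel x₁ (c₁ ⁻¹' D) = K₂.toKernel x₂ (c₂ ⁻¹' D))
    (hne : ∃ y y', c₁ y ≠ c₁ y') :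
    PolishBisimilar.{u₁, u₂, v₁, v₂, max u₁ u₂, max v₁ v₂} K₁ K₂ := by
  obtain ⟨y, y', hyy'⟩ := hne
  have exX₁ : ∀ x₁, ∃ x₂, e₁ x₁ = e₂ x₂ := fun x₁ =>
    (he ▸ Set.mem_range_self x₁ : e₁ x₁ ∈ Set.range e₂).imp fun _ h => h.symm
  have exX₂ : ∀ x₂, ∃ x₁, e₁ x₁ = e₂ x₂ := fun x₂ =>
    (he ▸ Set.mem_range_self x₂ : e₂ x₂ ∈ Set.range e₁)
  have exY₁ : ∀ y₁, ∃ y₂, c₁ y₁ = c₂ y₂ := fun y₁ =>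
    (hc ▸ Set.mem_range_self y₁ : c₁ y₁ ∈ Set.range c₂).imp fun _ h => h.symm
  have exY₂ : ∀ y₂, ∃ y₁, c₁ y₁ = c₂ y₂ := fun y₂ =>
    (hc ▸ Set.mem_range_self y₂ : c₂ y₂ ∈ Set.range c₁)
  obtain ⟨t, ht⟩ := exY₁ y
  obtain ⟨t', ht'⟩ := exY₁ y'
  have : Nonempty Y₁ := ⟨y⟩
  have : Nonempty Y₂ := ⟨t⟩
  have := K₁.isFiniteKernel
  have := K₂.isFiniteKernel
  let SA : Set (X₁ × X₂) := {p | e₁ p.1 = e₂ p.2}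
  let SB : Set (Y₁ × Y₂) := {p | c₁ p.1 = c₂ p.2}
  have hSA : MeasurableSet SA :=
    measurableSet_eq_fun (he₁.comp measurable_fst) (he₂.comp measurable_snd)
  have hSB : MeasurableSet SB :=
    measurableSet_eq_fun (hc₁.comp measurable_fst) (hc₂.comp measurable_snd)
  have hf₁ : Measurable fun a : SA => a.1.1 := measurable_fst.comp measurable_subtype_coe
  have hf₂ : Measurable fun a : SA => a.1.2 := measurable_snd.comp measurable_subtype_coe
  have hg₁ : Measurable fun b : SB => b.1.1 := measurable_fst.comp measurable_subtype_coe
  have hg₂ : Measurable fun b : SB => b.1.2 := measurable_snd.comp measurable_subtype_coe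
  obtain ⟨N, hN₁, hN₂, hN⟩ := Kernel.exists_coupling_of_map_eq
    (K₁.toKernel.comap _ hf₁) (K₂.toKernel.comap _ hf₂) hc₁ hc₂ (by
      ext a D hD
      rw [Kernel.map_apply' _ hc₁ _ hD, Kernel.map_apply' _ hc₂ _ hD]
      exact hK _ _ a.2 D hD)
  have hemb := MeasurableEmbedding.subtype_coe hSB
  -- The coupling gives no mass to the complement of `SB`, so restricting it there preserves both
  -- marginals.
  have hM : ∀ a, ∀ E : Set (Y₁ × Y₂), MeasurableSet E →
      N.comapRight hemb a (Subtype.val ⁻¹' E) = N a E := by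
    intro a E hE
    rw [Kernel.comapRight_apply' _ _ _ (hE.preimage measurable_subtype_coe),
      Subtype.image_preimage_coe, Set.inter_comm]
    exact measure_inter_conull (hN a)
  have hM₁ : ∀ a, ∀ D : Set Y₁, MeasurableSet D →
      N.comapRight hemb a ((fun b : SB => b.1.1) ⁻¹' D) = K₁.toKernel a.1.1 D := fun a D hD =>
    (hM a _ (hD.preimage measurable_fst)).trans (hN₁ a D hD)
  have hM₂ : ∀ a, ∀ D : Set Y₂, MeasurableSet D →
      N.comapRight hemb a ((fun b : SB => b.1.2) ⁻¹' D) = K₂.toKernel a.1.2 D := fun a D hD =>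
    (hM a _ (hD.preimage measurable_snd)).trans (hN₂ a D hD)
  have : StandardBorelSpace SA := hSA.standardBorel
  have : StandardBorelSpace SB := hSB.standardBorel
  -- A Borel subset need not be Polish in the subspace topology; a compatible Polish topology is
  -- chosen instead.
  let := upgradeStandardBorel SA
  let := upgradeStandardBorel SB
  refine ⟨SA, SB, inferInstance, inferInstance, inferInstance, inferInstance, inferInstance,
    inferInstance, inferInstance, inferInstance,
    ⟨N.comapRight hemb, fun a => ?_⟩, fun a => a.1.1, fun b => b.1.1, fun a => a.1.2,
    fun b => b.1.2, ⟨hf₁, hg₁, fun a D hD => (hM₁ a D hD).symm⟩,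
    ⟨hf₂, hg₂, fun a D hD => (hM₂ a D hD).symm⟩, ?_, ?_, ?_, ?_,
    (fun b : SB => c₁ b.1.1) ⁻¹' {c₁ y}, ?_, ?_, ?_⟩
  · exact (hM₁ a _ MeasurableSet.univ).trans_le (K₁.measure_univ_le_one _)
  · exact fun x₁ => (exX₁ x₁).elim fun x₂ h => ⟨⟨(x₁, x₂), h⟩, rfl⟩
  · exact fun y₁ => (exY₁ y₁).elim fun y₂ h => ⟨⟨(y₁, y₂), h⟩, rfl⟩
  · exact fun x₂ => (exX₂ x₂).elim fun x₁ h => ⟨⟨(x₁, x₂), h⟩, rfl⟩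
  · exact fun y₂ => (exY₂ y₂).elim fun y₁ h => ⟨⟨(y₁, y₂), h⟩, rfl⟩
  -- On `SB` the maps `c₁` and `c₂` agree, so a fibre of their common value is an event of both
  -- sides.
  · refine MeasurableSpace.measurableSet_inf.2
      ⟨⟨c₁ ⁻¹' {c₁ y}, hc₁ (measurableSet_singleton _), rfl⟩,
        ⟨c₂ ⁻¹' {c₁ y}, hc₂ (measurableSet_singleton _), ?_⟩⟩
    ext b
    have hb : c₁ b.1.1 = c₂ b.1.2 := b.2
    simp [hb]
  · exact Set.Nonempty.ne_empty ⟨⟨(y, t), ht⟩, rfl⟩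
  · intro huniv
    have hmem : (⟨(y', t'), ht'⟩ : SB) ∈ (fun b : SB => c₁ b.1.1) ⁻¹' {c₁ y} :=
      huniv ▸ Set.mem_univ _
    exact hyy' (Eq.symm hmem)

/-- The quotients need not be standard Borel, but measurable injections into Cantor space suffice:
injectivity turns equality of codes into equality of classes. Both sides are coded through the
second quotient, the first being carried there by the isomorphism. -/
theorem LogicallyEquivalentVia.polishBisimilar {K₁ : StochRel X₁ Y₁} {K₂ : StochRel X₂ Y₂}
    {r₁ : Setoid X₁} {s₁ : Setoid Y₁} {r₂ : Setoid X₂} {s₂ : Setoid Y₂}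
    (h : LogicallyEquivalentVia K₁ K₂ r₁ s₁ r₂ s₂) (hne : ∃ y y' : Y₁, ¬ s₁ y y') :
    PolishBisimilar.{u₁, u₂, v₁, v₂, max u₁ u₂, max v₁ v₂} K₁ K₂ := by
  obtain ⟨-, ⟨hr₂, hs₂, -⟩, F₁, F₂, hF₁, hF₂, φ, ψ, hφψ, -⟩ := h
  obtain ⟨d, hd, hd_inj⟩ := hr₂.exists_measurable_injective
  obtain ⟨d', hd', hd'_inj⟩ := hs₂.exists_measurable_injective
  refine PolishBisimilar.of_fibreProduct K₁ K₂
    (e₁ := d ∘ φ ∘ Quotient.mk r₁) (e₂ := d ∘ Quotient.mk r₂)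
    (c₁ := d' ∘ ψ ∘ Quotient.mk s₁) (c₂ := d' ∘ Quotient.mk s₂)
    (hd.comp (hφψ.measurable_fst.comp hF₁.measurable_fst)) (hd.comp hF₂.measurable_fst)
    (hd'.comp (hφψ.measurable_snd.comp hF₁.measurable_snd)) (hd'.comp hF₂.measurable_snd)
    ?_ ?_ ?_ ?_
  · rw [(φ.surjective.comp Quotient.mk_surjective).range_comp,
      Quotient.mk_surjective.range_comp]
  · rw [(ψ.surjective.comp Quotient.mk_surjective).range_comp,
      Quotient.mk_surjective.range_comp]
  · intro x₁ x₂ hx D hD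
    have hx' : φ (Quotient.mk r₁ x₁) = Quotient.mk r₂ x₂ := hd_inj hx
    calc K₁.toKernel x₁ (Quotient.mk s₁ ⁻¹' (ψ ⁻¹' (d' ⁻¹' D)))
        = F₁.toKernel (Quotient.mk r₁ x₁) (ψ ⁻¹' (d' ⁻¹' D)) :=
          (hF₁.comm x₁ _ (hφψ.measurable_snd (hd' hD))).symm
      _ = F₂.toKernel (φ (Quotient.mk r₁ x₁)) (d' ⁻¹' D) := (hφψ.comm _ _ (hd' hD)).symm
      _ = F₂.toKernel (Quotient.mk r₂ x₂) (d' ⁻¹' D) := by rw [hx']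
      _ = K₂.toKernel x₂ (Quotient.mk s₂ ⁻¹' (d' ⁻¹' D)) := hF₂.comm x₂ _ (hd' hD)
  · obtain ⟨y, y', hyy'⟩ := hne
    exact ⟨y, y', fun hc => hyy' (Quotient.exact (ψ.injective (hd'_inj hc)))⟩

theorem Bisimilar.polishBisimilar {K₁ : StochRel X₁ Y₁} {K₂ : StochRel X₂ Y₂}
    (h : Bisimilar.{u₁, u₂, v₁, v₂, w₁, w₂} K₁ K₂) :
    PolishBisimilar.{u₁, u₂, v₁, v₂, max u₁ u₂, max v₁ v₂} K₁ K₂ := by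
  obtain ⟨A, B, _, _, M, f₁, g₁, f₂, g₂, h₁, h₂, sf₁, sg₁, sf₂, sg₂, C, hC, hC₀, hC₁⟩ := h
  obtain ⟨⟨D₁, hD₁, hCD₁⟩, ⟨D₂, hD₂, hCD₂⟩⟩ := MeasurableSpace.measurableSet_inf.1 hC
  have hval₁ : ∀ a, ∀ D : Set Prop,
      K₁.toKernel (f₁ a) ((· ∈ D₁) ⁻¹' D) = M.toKernel a ((· ∈ C) ⁻¹' D) := by
    intro a D
    rw [h₁.comm a _ ((measurable_mem.2 hD₁) (MeasurableSet.of_discrete (s := D))), ← hCD₁]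
    rfl
  have hval₂ : ∀ a, ∀ D : Set Prop,
      K₂.toKernel (f₂ a) ((· ∈ D₂) ⁻¹' D) = M.toKernel a ((· ∈ C) ⁻¹' D) := by
    intro a D
    rw [h₂.comm a _ ((measurable_mem.2 hD₂) (MeasurableSet.of_discrete (s := D))), ← hCD₂]
    rfl
  have hmeas₁ : Measurable (· ∈ D₁) := measurable_mem.2 hD₁
  have hmeas₂ : Measurable (· ∈ D₂) := measurable_mem.2 hD₂
  -- Here `cᵢ` is the indicator of `Dᵢ`, and `eᵢ` records its law under `Kᵢ x` on the finitely many
  -- subsets of `Prop`.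
  refine PolishBisimilar.of_fibreProduct K₁ K₂ (W := Set Prop → ENNReal) (Z := Prop)
    (e₁ := fun x D => K₁.toKernel x ((· ∈ D₁) ⁻¹' D))
    (e₂ := fun x D => K₂.toKernel x ((· ∈ D₂) ⁻¹' D))
    (c₁ := (· ∈ D₁)) (c₂ := (· ∈ D₂)) ?_ ?_ hmeas₁ hmeas₂ ?_ ?_ ?_ ?_
  · exact measurable_pi_lambda _ fun D =>
      K₁.toKernel.measurable_coe (hmeas₁ (MeasurableSet.of_discrete (s := D)))
  · exact measurable_pi_lambda _ fun D =>
      K₂.toKernel.measurable_coe (hmeas₂ (MeasurableSet.of_discrete (s := D)))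
  -- Both laws pull back to the law of the indicator of `C` under `M`, so `e₁ ∘ f₁ = e₂ ∘ f₂`.
  · rw [← sf₁.range_comp, ← sf₂.range_comp]
    congr 1
    funext a D
    exact (hval₁ a D).trans (hval₂ a D).symm
  · rw [← sg₁.range_comp, ← sg₂.range_comp]
    congr 1
    exact congrArg (fun (S : Set B) b => b ∈ S) (hCD₁.trans hCD₂.symm)
  · exact fun x₁ x₂ hx D _ => congrFun hx D
  · obtain ⟨b, hb⟩ := Set.nonempty_iff_ne_empty.2 hC₀
    obtain ⟨b', hb'⟩ := (Set.ne_univ_iff_exists_notMem C).1 hC₁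
    rw [← hCD₁] at hb hb'
    exact ⟨g₁ b, g₁ b', fun heq => hb' (heq.mp hb)⟩

end

end StochRel

theorem mainTheorem1
    {X₁ : Type u₁} {Y₁ : Type v₁} {X₂ : Type u₂} {Y₂ : Type v₂}
    [TopologicalSpace X₁] [PolishSpace X₁] [MeasurableSpace X₁] [BorelSpace X₁]
    [TopologicalSpace Y₁] [PolishSpace Y₁] [MeasurableSpace Y₁] [BorelSpace Y₁]
    [TopologicalSpace X₂] [PolishSpace X₂] [MeasurableSpace X₂] [BorelSpace X₂]
    [TopologicalSpace Y₂] [PolishSpace Y₂] [MeasurableSpace Y₂] [BorelSpace Y₂]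
    (K₁ : StochRel X₁ Y₁) (K₂ : StochRel X₂ Y₂) :
    (∀ (r₁ : Setoid X₁) (s₁ : Setoid Y₁) (r₂ : Setoid X₂) (s₂ : Setoid Y₂),
      StochRel.LogicallyEquivalentVia K₁ K₂ r₁ s₁ r₂ s₂ →
      (∃ y y' : Y₁, ¬ s₁ y y') →
      StochRel.PolishBisimilar.{u₁, u₂, v₁, v₂, max u₁ u₂, max v₁ v₂} K₁ K₂) ∧
    (StochRel.Bisimilar.{u₁, u₂, v₁, v₂, w₁, w₂} K₁ K₂ →
      StochRel.PolishBisimilar.{u₁, u₂, v₁, v₂, max u₁ u₂, max v₁ v₂} K₁ K₂) := by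
  exact ⟨fun _ _ _ _ h hne => h.polishBisimilar hne, fun h => h.polishBisimilar⟩
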